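/- Let $N$ be a natural number with $N\equiv 2 \pmod 4$, and let $$|H_N^3\rangle=\prod_{e\subseteq\{1,\dots,N\},\ |e|=3} C_e\,|+\rangle^{\otimes N}\in(\mathbb C^2)^{\otimes N}$$ be the three-uniform complete $N$-qubit hypergraph state, where $|+\rangle=\tfrac{1}{\sqrt2}(|0\rangle+|1\rangle)$ and $C_e=\mathbb 1-2|1\dots1\rangle\langle1\dots1|$ (projector on the qubits in $e$, identity on the others). Then $|H_N^3\rangle$ is stabilised by $X^{\otimes N}$, i.e. $X^{\otimes N}|H_N^3\rangle=|H_N^3\rangle$ with $X$ the Pauli operator $\sigma_x$, and its geometric measure of entanglement $$E_G(|\psi\rangle)=1-\max_{|\phi\rangle=|a_1\rangle\otimes\cdots\otimes|a_N\rangle}|\langle\phi|\psi\rangle|^2$$ (maximum over all tensor products of unit vectors $|a_i\rangle\in\mathbb C^2$) equals $$E_G(|H_N^3\rangle)=\frac34-\frac{1}{\sqrt2^{\,N}}-\frac{1}{2^N}.$$ -/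

import Mathlib

namespace QHypergraph

noncomputable section

/-- The state space of qubits labelled by `V`: the Hilbert space with orthonormal computational
basis `|x⟩`, `x : V → {0, 1}`. -/
abbrev QubitSpace (V : Type*) := EuclideanSpace ℂ (V → Fin 2)

/-- The product vector `⨂ᵢ aᵢ`, whose coordinate at `x` is `∏ᵢ aᵢ(xᵢ)`. -/
def productVector {V : Type*} [Fintype V] (a : V → EuclideanSpace ℂ (Fin 2)) : QubitSpace V :=
  WithLp.toLp 2 fun x => ∏ i, a i (x i)

/-- The operator `⨂ᵢ Aᵢ`, in the computational basis. -/
def productOperator {V : Type*} [Fintype V] (A : V → Matrix (Fin 2) (Fin 2) ℂ) :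
    Matrix (V → Fin 2) (V → Fin 2) ℂ :=
  Matrix.of fun x y => ∏ i, A i (x i) (y i)

/-- The Pauli operator `X`. -/
def pauliX : Matrix (Fin 2) (Fin 2) ℂ := !![0, 1; 1, 0]

/-- The qubit state `|+⟩ = (|0⟩ + |1⟩) / √2`. -/
def plusState : EuclideanSpace ℂ (Fin 2) := !₂[1 / (Real.sqrt 2 : ℂ), 1 / (Real.sqrt 2 : ℂ)]

/-- The projector `|1…1⟩⟨1…1|` on the qubits in `e`, tensored with the identity on the others. -/
def onesProjector {V : Type*} [Fintype V] [DecidableEq V] (e : Finset V) :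
    Matrix (V → Fin 2) (V → Fin 2) ℂ :=
  Matrix.diagonal fun x => if ∀ i ∈ e, x i = 1 then 1 else 0

/-- The generalized controlled-`Z` gate `C_e = 1 - 2 |1…1⟩⟨1…1|` on the qubits in `e`. -/
def cGate {V : Type*} [Fintype V] [DecidableEq V] (e : Finset V) :
    Matrix (V → Fin 2) (V → Fin 2) ℂ :=
  1 - (2 : ℂ) • onesProjector e

theorem cGate_commute {V : Type*} [Fintype V] [DecidableEq V] (e f : Finset V) :
    Commute (cGate e) (cGate f) := by
  have h : Commute (onesProjector e) (onesProjector f) := by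
    unfold Commute SemiconjBy onesProjector
    simp [Matrix.diagonal_mul_diagonal, mul_comm]
  have h2 : Commute ((2 : ℂ) • onesProjector e) ((2 : ℂ) • onesProjector f) :=
    (h.smul_left _).smul_right _
  exact (Commute.one_left _).sub_left ((Commute.one_right _).sub_right h2)

/-- The hypergraph state `|H⟩ = ∏_{e ∈ E} C_e |+⟩^{⊗ V}` of the hypergraph `H = (V, E)`. -/
def hypergraphState {V : Type*} [Fintype V] [DecidableEq V] (E : Finset (Finset V)) :
    QubitSpace V :=
  Matrix.toEuclideanLin (E.noncommProd cGate fun e _ f _ _ => cGate_commute e f)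
    (productVector fun _ => plusState)

/-- The `k`-uniform complete `N`-qubit hypergraph state: every set of exactly `k` vertices is a
hyperedge. -/
def uniformCompleteState (k N : ℕ) : QubitSpace (Fin N) :=
  hypergraphState (Finset.powersetCard k (Finset.univ : Finset (Fin N)))

/-- The squared overlaps `|⟨φ|ψ⟩|²` of `ψ` with the (normalized, fully) product states `φ`. -/
def productOverlaps {V : Type*} [Fintype V] [DecidableEq V] (ψ : QubitSpace V) : Set ℝ :=
  {t | ∃ a : V → EuclideanSpace ℂ (Fin 2), (∀ i, ‖a i‖ = 1) ∧
    t = ‖inner ℂ (productVector a) ψ‖ ^ 2}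

/-- The geometric measure of entanglement: one minus the largest squared overlap with a
product state. -/
def geometricMeasure {V : Type*} [Fintype V] [DecidableEq V] (ψ : QubitSpace V) : ℝ :=
  1 - sSup (productOverlaps ψ)

/-- The supremum in `geometricMeasure` is a maximum. -/
theorem isGreatest_productOverlaps {V : Type*} [Fintype V] [DecidableEq V] (ψ : QubitSpace V) :
    IsGreatest (productOverlaps ψ) (sSup (productOverlaps ψ)) := by
  have hK : IsCompact (Set.univ.pi fun _ : V =>
      Metric.sphere (0 : EuclideanSpace ℂ (Fin 2)) 1) :=
    isCompact_univ_pi fun _ => isCompact_sphere _ _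
  have hc : Continuous fun a : V → EuclideanSpace ℂ (Fin 2) =>
      ‖inner ℂ (productVector a) ψ‖ ^ 2 := by
    unfold productVector
    fun_prop
  have himg : productOverlaps ψ = (fun a : V → EuclideanSpace ℂ (Fin 2) =>
      ‖inner ℂ (productVector a) ψ‖ ^ 2) '' (Set.univ.pi fun _ : V =>
      Metric.sphere (0 : EuclideanSpace ℂ (Fin 2)) 1) := by
    ext t
    simp [productOverlaps, eq_comm]
  have hne : (productOverlaps ψ).Nonempty :=
    ⟨_, fun _ => EuclideanSpace.single 0 1, fun _ => by simp, rfl⟩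
  have hcomp : IsCompact (productOverlaps ψ) := himg ▸ hK.image hc
  exact hcomp.isGreatest_sSup hne

end

end QHypergraph

namespace QHypergraph

open Complex

/-! The amplitude at `x` has sign `(-1) ^ w.choose 3` with `w` the Hamming weight. This sign has
period 4 in `w`, so Fourier expansion writes the state as a combination of the four product states
`|c⟩^{⊗N}`, `c = 1, -1, I, -I`, with coefficients of modulus 1/2. An overlap with a product state is
thus half a unimodular combination of four products. For the upper bound, the triangle inequality
and AM-GM reduce everything to one qubit, where a sum of four powers has to be bounded; only `N = 2
* M` is needed. The bound `1 / 2 + (1 / 2) ^ M` is attained at `|+⟩^{⊗N}` or `|-⟩^{⊗N}` when `M` is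
odd. -/

theorem neg_one_pow_choose_three {R : Type*} [Ring R] (w : ℕ) :
    (-1 : R) ^ w.choose 3 = if w % 4 = 3 then -1 else 1 := by
  -- Pascal's rule gives `C(n+4,3) = C(n,3) + 4 C(n,2) + 6 n + 4`, so the parity is unchanged.
  have key : ∀ q r : ℕ, (4 * q + r).choose 3 % 2 = r.choose 3 % 2 := by
    intro q r
    induction q with
    | zero => simp
    | succ q ih =>
      rw [← ih, show 4 * (q + 1) + r = 4 * q + r + 1 + 1 + 1 + 1 by ring]
      generalize 4 * q + r = n
      simp only [Nat.choose_succ_succ', Nat.choose_zero_right, Nat.choose_one_right,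
        Nat.reduceAdd]
      omega
  have hw := key (w / 4) (w % 4)
  rw [Nat.div_add_mod] at hw
  have hr : w % 4 < 4 := Nat.mod_lt _ (by norm_num)
  generalize w % 4 = r at hw hr
  have hpar : (-1 : R) ^ w.choose 3 = (-1) ^ r.choose 3 := by
    rw [neg_one_pow_eq_pow_mod_two, hw, ← neg_one_pow_eq_pow_mod_two]
  rw [hpar]
  interval_cases r <;> simp [Nat.choose]

/-- The discrete Fourier expansion of the sign `(-1) ^ (w choose 3)`, of period `4` in `w`. -/
theorem neg_one_pow_choose_three_eq_sum (w : ℕ) :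
    (-1 : ℂ) ^ w.choose 3 = (1 + (-1) ^ w - I * I ^ w + I * (-I) ^ w) / 2 := by
  rw [neg_one_pow_choose_three]
  have hI : I ^ 4 = 1 := I_pow_four
  have hI' : (-I) ^ 4 = 1 := by rw [Even.neg_pow (by decide)]; exact hI
  have h1 : (-1 : ℂ) ^ 4 = 1 := by norm_num
  have hr : w % 4 < 4 := Nat.mod_lt _ (by norm_num)
  rw [pow_eq_pow_mod w h1, pow_eq_pow_mod w hI, pow_eq_pow_mod w hI']
  generalize w % 4 = r at hr
  interval_cases r <;> simp [pow_succ]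

/-! ### Amplitudes of hypergraph states and the action of `X^{⊗N}` -/

section States

variable {V : Type*} [Fintype V]

/-- The Hamming weight of a bit string. -/
def bitWeight (x : V → Fin 2) : ℕ := (Finset.univ.filter fun i => x i = 1).card

theorem cGate_eq_diagonal [DecidableEq V] (e : Finset V) :
    cGate e = Matrix.diagonal fun x => if ∀ i ∈ e, x i = 1 then -1 else 1 := by
  ext x y
  by_cases h : x = y
  · subst h
    simp only [cGate, onesProjector, Matrix.sub_apply, Matrix.one_apply_eq, Matrix.smul_apply,
      Matrix.diagonal_apply_eq, smul_eq_mul]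
    split_ifs <;> norm_num
  · simp [cGate, onesProjector, h]

theorem noncommProd_cGate [DecidableEq V] (E : Finset (Finset V))
    (h : (E : Set (Finset V)).Pairwise (Function.onFun Commute cGate)) :
    E.noncommProd cGate h =
      Matrix.diagonal fun x => (-1) ^ (E.filter fun e => ∀ i ∈ e, x i = 1).card := by
  induction E using Finset.induction_on with
  | empty => simp
  | insert e E he ih =>
    rw [Finset.noncommProd_insert_of_notMem _ _ _ _ he, ih, cGate_eq_diagonal,
      Matrix.diagonal_mul_diagonal]
    congr 1
    ext x
    rw [Finset.filter_insert]
    split_ifs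
    · rw [Finset.card_insert_of_notMem (by simp [he]), pow_succ']
    · simp

theorem hypergraphState_apply [DecidableEq V] (E : Finset (Finset V)) (x : V → Fin 2) :
    hypergraphState E x = (-1) ^ (E.filter fun e => ∀ i ∈ e, x i = 1).card *
      (1 / (Real.sqrt 2 : ℂ)) ^ Fintype.card V := by
  have hp : ∀ b : Fin 2, plusState b = 1 / (Real.sqrt 2 : ℂ) := by
    intro b; fin_cases b <;> simp [plusState]
  have h : hypergraphState E = Matrix.toEuclideanLin (Matrix.diagonal fun x =>
      (-1) ^ (E.filter fun e => ∀ i ∈ e, x i = 1).card) (productVector fun _ => plusState) :=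
    congrArg (fun A => Matrix.toEuclideanLin A (productVector fun _ => plusState))
      (noncommProd_cGate E fun e _ f _ _ => cGate_commute e f)
  rw [h]
  simp [Matrix.toLpLin_apply, Matrix.mulVec_diagonal, productVector, hp]

theorem uniformCompleteState_apply (k N : ℕ) (x : Fin N → Fin 2) :
    uniformCompleteState k N x =
      (-1) ^ (bitWeight x).choose k * (1 / (Real.sqrt 2 : ℂ)) ^ N := by
  rw [uniformCompleteState, hypergraphState_apply, Fintype.card_fin, bitWeight,
    ← Finset.card_powersetCard]
  congr 3
  ext e
  simp only [Finset.mem_filter, Finset.mem_powersetCard, Finset.subset_iff, Finset.mem_univ,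
    true_and, implies_true]
  tauto

theorem pow_bitWeight (c : ℂ) (x : V → Fin 2) :
    c ^ bitWeight x = ∏ i, if x i = 1 then c else 1 := by
  rw [bitWeight, ← Finset.prod_const, Finset.prod_filter]

/-- The generating function of bit strings by weight factorizes over the qubits. -/
theorem sum_pow_bitWeight_mul_prod [DecidableEq V] (c : ℂ) (f : V → Fin 2 → ℂ) :
    ∑ x : V → Fin 2, c ^ bitWeight x * ∏ i, f i (x i) = ∏ i, (f i 0 + c * f i 1) := by
  simp_rw [pow_bitWeight, ← Finset.prod_mul_distrib]
  rw [← Fintype.piFinset_univ,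
    ← Finset.prod_univ_sum (fun _ => Finset.univ)
      (fun i b => (if b = (1 : Fin 2) then c else 1) * f i b)]
  simp

theorem productOperator_pauliX_apply [DecidableEq V] (ψ : QubitSpace V) (x : V → Fin 2) :
    Matrix.toEuclideanLin (productOperator fun _ : V => pauliX) ψ x = ψ fun i => 1 - x i := by
  have hX : ∀ b c : Fin 2, pauliX b c = if c = 1 - b then 1 else 0 := by
    intro b c; fin_cases b <;> fin_cases c <;> simp [pauliX]
  have hP : ∀ y : V → Fin 2, productOperator (fun _ : V => pauliX) x y =
      if y = (fun i => 1 - x i) then 1 else 0 := by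
    intro y
    simp only [productOperator, Matrix.of_apply, hX, Finset.prod_ite_zero, funext_iff,
      Finset.mem_univ, true_imp_iff, Finset.prod_const_one]
  simp [Matrix.toLpLin_apply, Matrix.mulVec, dotProduct, hP]

theorem bitWeight_flip_add (x : V → Fin 2) :
    bitWeight (fun i => 1 - x i) + bitWeight x = Fintype.card V := by
  have h : ∀ b : Fin 2, 1 - b = 1 ↔ ¬ b = 1 := by decide
  simp only [bitWeight, h]
  rw [add_comm, Finset.card_filter_add_card_filter_not, Finset.card_univ]

end States

theorem pauliX_stabilizes_uniformCompleteState {N : ℕ} (hN : N % 4 = 2) :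
    Matrix.toEuclideanLin (productOperator fun _ : Fin N => pauliX) (uniformCompleteState 3 N) =
      uniformCompleteState 3 N := by
  ext x
  rw [productOperator_pauliX_apply, uniformCompleteState_apply, uniformCompleteState_apply,
    neg_one_pow_choose_three, neg_one_pow_choose_three]
  have h := bitWeight_flip_add x
  rw [Fintype.card_fin] at h
  congr 2
  -- Flipping all bits sends weight `w` to `N - w`, and for `N ≡ 2 mod 4` this preserves the class
  -- `3 mod 4`.
  exact propext (by omega)

/-! ### Overlaps with product states and the upper bound -/

/-- `⟨a|c⟩` for the vector `|c⟩ = (|0⟩ + c|1⟩) / √2`. -/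
noncomputable def phaseOverlap (c : ℂ) (a : EuclideanSpace ℂ (Fin 2)) : ℂ :=
  1 / (Real.sqrt 2 : ℂ) * (star (a 0) + c * star (a 1))

theorem inner_productVector_uniformCompleteState (N : ℕ)
    (a : Fin N → EuclideanSpace ℂ (Fin 2)) :
    inner ℂ (productVector a) (uniformCompleteState 3 N) =
      (∏ i, phaseOverlap 1 (a i) + ∏ i, phaseOverlap (-1) (a i)
        - I * ∏ i, phaseOverlap I (a i) + I * ∏ i, phaseOverlap (-I) (a i)) / 2 := by
  have hprod : ∀ c : ℂ, ∏ i, phaseOverlap c (a i) = (1 / (Real.sqrt 2 : ℂ)) ^ N *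
      ∑ x : Fin N → Fin 2, c ^ bitWeight x * ∏ i, star (a i (x i)) := by
    intro c
    rw [sum_pow_bitWeight_mul_prod c fun i b => star (a i b)]
    simp only [phaseOverlap, Finset.prod_mul_distrib, Finset.prod_const, Finset.card_univ,
      Fintype.card_fin]
  simp only [hprod, Finset.mul_sum]
  rw [← Finset.sum_add_distrib, ← Finset.sum_sub_distrib, ← Finset.sum_add_distrib,
    Finset.sum_div, PiLp.inner_apply]
  refine Finset.sum_congr rfl fun x _ => ?_
  rw [uniformCompleteState_apply, neg_one_pow_choose_three_eq_sum]
  simp only [productVector, RCLike.inner_apply, map_prod, one_pow, RCLike.star_def]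
  ring

/-- Only even powers of `x` survive on the left; each nonconstant one is at most `x ^ 2`, and their
coefficients add up to `2 ^ M - 2`. -/
theorem one_add_pow_add_one_sub_pow_le {x : ℝ} (hx : x ^ 2 ≤ 1) {M : ℕ} (hM : 1 ≤ M) :
    (1 + x) ^ M + (1 - x) ^ M ≤ 2 + x ^ 2 * (2 ^ M - 2) := by
  -- With `S`, `D` the sum and difference of the two powers, raising `M` by one turns `S` into `S +
  -- x D` and `x D` into `x D + x ^ 2 S`, so both bounds are carried together.
  have key : (1 + x) ^ M + (1 - x) ^ M ≤ 2 + x ^ 2 * (2 ^ M - 2) ∧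
      x * ((1 + x) ^ M - (1 - x) ^ M) ≤ 2 ^ M * x ^ 2 := by
    induction M, hM using Nat.le_induction with
    | base => constructor <;> nlinarith
    | succ M hM ih =>
      obtain ⟨h1, h2⟩ := ih
      have h3 : (2 : ℝ) ≤ 2 ^ M := by simpa using pow_le_pow_right₀ one_le_two hM
      have h4 : (1 + x) ^ M + (1 - x) ^ M ≤ 2 ^ M := by nlinarith
      have h5 := mul_le_mul_of_nonneg_left h4 (sq_nonneg x)
      simp only [pow_succ _ M]
      constructor <;> linarith
  exact key.1

theorem norm_phaseOverlap_sq {c : ℂ} (hc : ‖c‖ = 1) {a : EuclideanSpace ℂ (Fin 2)}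
    (ha : ‖a‖ = 1) :
    ‖phaseOverlap c a‖ ^ 2 = (1 + 2 * (c * (a 0 * star (a 1))).re) / 2 := by
  have h := EuclideanSpace.norm_sq_eq a
  rw [ha, Fin.sum_univ_two] at h
  have hs : ‖(1 / (Real.sqrt 2 : ℂ))‖ ^ 2 = 1 / 2 := by
    rw [norm_div, norm_real, div_pow]; simp
  have hc2 : normSq c = 1 := by rw [normSq_eq_norm_sq, hc]; norm_num
  rw [phaseOverlap, norm_mul, mul_pow, hs, ← normSq_eq_norm_sq, normSq_add, normSq_mul, hc2]
  simp only [← normSq_eq_norm_sq] at h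
  simp only [RCLike.star_def, normSq_conj, map_mul, conj_conj]
  have : ((starRingEnd ℂ) (a 0) * ((starRingEnd ℂ) c * a 1)).re =
      (c * (a 0 * (starRingEnd ℂ) (a 1))).re := by
    simp [mul_re, mul_im]; ring
  rw [this]
  linarith

/-- The squared overlaps are `(1 ± x) / 2` and `(1 ± y) / 2`, where `x`, `y` are, up to sign, the
equatorial Bloch coordinates of `a`. The previous inequality is linear in `x ^ 2` and `y ^ 2`, so `x
^ 2 + y ^ 2 ≤ 1` finishes. -/
theorem sum_norm_phaseOverlap_pow_le {M : ℕ} (hM : 1 ≤ M) {a : EuclideanSpace ℂ (Fin 2)}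
    (ha : ‖a‖ = 1) :
    ‖phaseOverlap 1 a‖ ^ (2 * M) + ‖phaseOverlap (-1) a‖ ^ (2 * M)
      + ‖phaseOverlap I a‖ ^ (2 * M) + ‖phaseOverlap (-I) a‖ ^ (2 * M) ≤
      1 + 2 * (1 / 2) ^ M := by
  simp only [pow_mul]
  rw [norm_phaseOverlap_sq (by simp) ha, norm_phaseOverlap_sq (by simp) ha,
    norm_phaseOverlap_sq (by simp) ha, norm_phaseOverlap_sq (by simp) ha]
  have h := EuclideanSpace.norm_sq_eq a
  rw [ha, Fin.sum_univ_two] at h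
  set z : ℂ := a 0 * star (a 1) with hz
  have hzn : z.re ^ 2 + z.im ^ 2 = ‖a 0‖ ^ 2 * ‖a 1‖ ^ 2 := by
    rw [← mul_pow, ← norm_star (a 1), ← norm_mul, ← hz, ← normSq_eq_norm_sq, normSq_apply]
    ring
  have hxy : (2 * z.re) ^ 2 + (2 * z.im) ^ 2 ≤ 1 := by
    nlinarith [sq_nonneg (‖a 0‖ ^ 2 - ‖a 1‖ ^ 2)]
  have hx := one_add_pow_add_one_sub_pow_le (x := 2 * z.re) (by nlinarith [sq_nonneg z.im]) hM
  have hy := one_add_pow_add_one_sub_pow_le (x := 2 * z.im) (by nlinarith [sq_nonneg z.re]) hM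
  have h2 : (2 : ℝ) ≤ 2 ^ M := by simpa using pow_le_pow_right₀ one_le_two hM
  have h3 := mul_le_mul_of_nonneg_right hxy (sub_nonneg.2 h2)
  have e1 : (1 * z).re = z.re := by simp
  have e2 : (-1 * z).re = -z.re := by simp
  have e3 : (I * z).re = -z.im := by simp
  have e4 : (-I * z).re = z.im := by simp
  have hpos : (0 : ℝ) < 2 ^ M := by positivity
  simp only [e1, e2, e3, e4, div_pow, one_pow, mul_neg, ← sub_eq_add_neg]
  rw [← sub_nonneg]
  field_simp
  linarith

theorem prod_le_sum_pow_card_div {n : ℕ} (hn : n ≠ 0) (f : Fin n → ℝ) (hf : ∀ i, 0 ≤ f i) :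
    ∏ i, f i ≤ (∑ i, f i ^ n) / n := by
  have hn' : (n : ℝ) ≠ 0 := Nat.cast_ne_zero.2 hn
  have h := Real.geom_mean_le_arith_mean_weighted Finset.univ (fun _ : Fin n => (n : ℝ)⁻¹)
    (fun i => f i ^ n) (fun _ _ => by positivity) (by simp [hn'])
    (fun i _ => pow_nonneg (hf i) n)
  simp only [Real.pow_rpow_inv_natCast (hf _) hn, ← Finset.mul_sum] at h
  rwa [div_eq_inv_mul]

/-- AM-GM replaces each product over qubits by the average of `2 * M`-th powers, so the one-qubit
bound applies to each qubit separately. -/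
theorem norm_inner_uniformCompleteState_le {M : ℕ} (hM : 1 ≤ M)
    (a : Fin (2 * M) → EuclideanSpace ℂ (Fin 2)) (ha : ∀ i, ‖a i‖ = 1) :
    ‖inner ℂ (productVector a) (uniformCompleteState 3 (2 * M))‖ ≤ 1 / 2 + (1 / 2) ^ M := by
  have hn : 2 * M ≠ 0 := by omega
  have hprod : ∀ c : ℂ, ‖∏ i, phaseOverlap c (a i)‖ ≤
      (∑ i, ‖phaseOverlap c (a i)‖ ^ (2 * M)) / (2 * M : ℕ) := fun c => by
    rw [norm_prod]
    exact prod_le_sum_pow_card_div hn _ fun _ => norm_nonneg _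
  have hsum := Finset.sum_le_sum fun i (_ : i ∈ Finset.univ) =>
    sum_norm_phaseOverlap_pow_le hM (ha i)
  simp only [Finset.sum_add_distrib, Finset.sum_const, Finset.card_univ, Fintype.card_fin,
    nsmul_eq_mul] at hsum
  have hpos : (0 : ℝ) < (2 * M : ℕ) := by positivity
  have hdiv := (div_le_iff₀' hpos).2 (hsum.trans_eq (mul_add _ _ _).symm)
  simp only [add_div] at hdiv
  rw [inner_productVector_uniformCompleteState, norm_div, Complex.norm_ofNat]
  have htri := norm_add_le (∏ i, phaseOverlap 1 (a i) + ∏ i, phaseOverlap (-1) (a i)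
        - I * ∏ i, phaseOverlap I (a i)) (I * ∏ i, phaseOverlap (-I) (a i))
  have htri' := norm_sub_le (∏ i, phaseOverlap 1 (a i) + ∏ i, phaseOverlap (-1) (a i))
    (I * ∏ i, phaseOverlap I (a i))
  have htri'' := norm_add_le (∏ i, phaseOverlap 1 (a i)) (∏ i, phaseOverlap (-1) (a i))
  rw [norm_mul, norm_I, one_mul] at htri htri'
  linarith [hprod 1, hprod (-1), hprod I, hprod (-I)]

/-! ### Attainment of the bound -/

/-- The state `(|0⟩ + s|1⟩) / √2` for a real `s`; it is `|±⟩` for `s = ±1`. -/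
noncomputable def signState (s : ℝ) : EuclideanSpace ℂ (Fin 2) :=
  !₂[1 / (Real.sqrt 2 : ℂ), s / (Real.sqrt 2 : ℂ)]

theorem norm_signState {s : ℝ} (hs : s ^ 2 = 1) : ‖signState s‖ = 1 := by
  rw [EuclideanSpace.norm_eq, Fin.sum_univ_two]
  simp [signState, hs, div_pow]
  norm_num

theorem phaseOverlap_signState (c : ℂ) (s : ℝ) :
    phaseOverlap c (signState s) = (1 + c * s) / 2 := by
  have h : (Real.sqrt 2 : ℂ) ^ 2 = 2 := by
    rw [← ofReal_pow, Real.sq_sqrt (by norm_num)]; norm_num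
  have h0 : (Real.sqrt 2 : ℂ) ≠ 0 := by
    intro h0; rw [h0] at h; norm_num at h
  simp only [phaseOverlap, signState, PiLp.toLp_apply, Matrix.cons_val_zero, Matrix.cons_val_one,
    RCLike.star_def, map_div₀, map_one, conj_ofReal]
  field_simp
  rw [h]
  ring

/-- One of the overlaps with `|±⟩` is 1 and the other 0. The sign `(-1) ^ m` is chosen so that the
two terms from `c = ±I` both equal `+(1 / 2) ^ (2 * m + 1)` before the final halving, making the
triangle inequality sharp. -/
theorem inner_signState_uniformCompleteState (m : ℕ) :
    inner ℂ (productVector fun _ => signState ((-1) ^ m))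
      (uniformCompleteState 3 (2 * (2 * m + 1))) = 1 / 2 + (1 / 2 : ℂ) ^ (2 * m + 1) := by
  have hp : ((1 + I * 1) / 2 : ℂ) ^ 2 = I / 2 := by linear_combination I_sq / 4
  have hm : ((1 + I * -1) / 2 : ℂ) ^ 2 = -I / 2 := by linear_combination I_sq / 4
  have hI : I ^ (2 * m + 1) = (-1) ^ m * I := by rw [pow_succ, pow_mul, I_sq]
  have hnI : (-I) ^ (2 * m + 1) = -((-1) ^ m * I) := by rw [Odd.neg_pow (by simp), hI]
  rw [inner_productVector_uniformCompleteState]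
  simp only [phaseOverlap_signState, Finset.prod_const, Finset.card_univ, Fintype.card_fin,
    pow_mul _ 2]
  rcases Nat.even_or_odd m with he | ho
  · simp only [he.neg_one_pow, neg_mul, ofReal_one, ← mul_neg, hp, hm, div_pow, hI, hnI]
    norm_num
    ring_nf
    simp only [I_sq]
    ring
  · simp only [ho.neg_one_pow, neg_mul, ofReal_one, ofReal_neg, neg_neg, mul_neg]
    simp only [← mul_neg, hp, hm, div_pow, hI, hnI, ho.neg_one_pow]
    norm_num
    ring_nf
    simp only [I_sq]
    ring

theorem isGreatest_productOverlaps_uniformCompleteState (m : ℕ) :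
    IsGreatest (productOverlaps (uniformCompleteState 3 (2 * (2 * m + 1))))
      ((1 / 2 + (1 / 2) ^ (2 * m + 1)) ^ 2) := by
  constructor
  · refine ⟨fun _ => signState ((-1) ^ m), fun _ => norm_signState ?_, ?_⟩
    · rw [← pow_mul, mul_comm, pow_mul]; norm_num
    · rw [inner_signState_uniformCompleteState]
      have : (1 / 2 + (1 / 2 : ℂ) ^ (2 * m + 1)) = ((1 / 2 + (1 / 2) ^ (2 * m + 1) : ℝ) : ℂ) := by
        push_cast; ring
      rw [this, norm_real, Real.norm_eq_abs, sq_abs]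
  · rintro t ⟨a, ha, rfl⟩
    exact pow_le_pow_left₀ (norm_nonneg _)
      (norm_inner_uniformCompleteState_le (by omega) a ha) 2

end QHypergraph

/-- For `N ≡ 2 mod 4`, the three-uniform complete `N`-qubit hypergraph state is stabilised by
`X^{⊗N}`, and its geometric measure of entanglement is `3/4 - 1/√2^N - 1/2^N`. -/
theorem mainTheorem2 (N : ℕ) (hN : N % 4 = 2) :
    Matrix.toEuclideanLin (QHypergraph.productOperator fun _ : Fin N => QHypergraph.pauliX)
        (QHypergraph.uniformCompleteState 3 N) = QHypergraph.uniformCompleteState 3 N ∧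
      QHypergraph.geometricMeasure (QHypergraph.uniformCompleteState 3 N) =
        3 / 4 - 1 / Real.sqrt 2 ^ N - 1 / 2 ^ N := by
  refine ⟨QHypergraph.pauliX_stabilizes_uniformCompleteState hN, ?_⟩
  obtain ⟨m, rfl⟩ : ∃ m, N = 2 * (2 * m + 1) := ⟨N / 4, by omega⟩
  rw [QHypergraph.geometricMeasure,
    (QHypergraph.isGreatest_productOverlaps_uniformCompleteState m).csSup_eq,
    pow_mul (Real.sqrt 2), Real.sq_sqrt (by norm_num), mul_comm 2 (2 * m + 1),
    pow_mul (2 : ℝ), one_div_pow]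
  field_simp
  ring
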